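/- **Setting.** Let $\mathcal X,\mathcal Y$ be measurable spaces, $m\ge 2$ a number of bins, $T\ge 1$ a time horizon, $\tau_{\max}>0$, $\alpha\in[0,1]$, and let $s_t:\mathcal X\times\mathcal Y\to[0,\tau_{\max}]$ be any measurable score functions ($s_t$ may depend on the data and thresholds of rounds $1,\dots,t-1$). A threshold $\tau_t$ gives the predictor $\hat C_t(x)=\{y: s_t(x,y)\ge\tau_t\}$, and $\mathrm{Miscover}(\hat C,x,y)=\mathbb 1(y\notin\hat C(x))$. Put $f(n)=\sqrt{(n+1)\log_2^2(n+2)}$, $B_i=[\tau_{\max}\frac{i-1}{m},\tau_{\max}\frac im)$ for $1\le i<m$, and $B_m=[\tau_{\max}\frac{m-1}{m},\tau_{\max}]$. **MVP learner (single group)** with learning rate $\eta$, resolution $r\ge1$ and an arbitrary first threshold $\tau_1\in[0,\tau_{\max}]$. After each round let $n_i$ be the number of past rounds $t$ with $\tau_t\in B_i$, let $v_i$ be the sum of $\alpha-\mathbb 1(y_t\notin\hat C_t(x_t))$ over these rounds, and $w_i=e^{\eta v_i/f(n_i)}-e^{-\eta v_i/f(n_i)}$. If $w_iw_{i+1}\le0$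 for some $1\le i<m$, take the least such $i$ and put $b=|w_{i+1}|/(|w_{i+1}|+|w_i|)$ (with $0/0=1$); the next threshold is $\tau_{\max}\big(\frac im-\frac1{rm}\big)$ with probability $b$ and $\tau_{\max}\frac im$ with probability $1-b$. Otherwise it is $\tau_{\max}$ if all $w_i>0$, and $0$ if all $w_i<0$. **Value.** For $\rho>0$ let $\mathcal P'_\rho$ be the set of probability distributions of $(X_t,Y_t)$ on $\mathcal X\times\mathcal Y$ under which the score $s_t(X_t,Y_t)$ is $\rho$-smooth: it falls in any given interval of length at most $\tau_{\max}/(rm)$ with probability at most $\rho$. For the MVP learner $L$ let $$\mathcal V'=\sup_{p_1\in\mathcal P'_\rho}\ \mathbb E_{(X_1,Y_1)\sim p_1,\ \hat C_1\sim L}\ \cdots\ \sup_{p_T\in\mathcal P'_\rho}\ \mathbb E_{(X_T,Y_T)\sim p_T,\ \hat C_T\sim L}\ \left|\frac1T\sum_{t=1}^T\mathrm{Miscover}(\hat C_t,X_t,Y_t)-\alpha\right|,$$ where each $p_t$ is chosen knowing rounds $1,\dots,t-1$, and $(X_t,Y_t)$ and $\hat C_t$ are drawn independently given these (a non-measurable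 integrand is integrated by the outer integral). **Claim.** For all $m\ge2$ and $T\ge1$ there is $\rho_0>0$, depending only on $m$ and $T$, such that for all data as above, all $0<\rho\le\rho_0$ (that is, if the score distributions are smooth enough) and all $\eta$ with $$\sqrt{\frac{\ln m}{6.8\,m}}\le\eta\le\sqrt{\frac{\ln m}{6.6\,m}},$$ every possible run of the MVP learner, with thresholds $\tau_1,\dots,\tau_T$ and $S_i=\{t\in\{1,\dots,T\}:\tau_t\in B_i\}$, satisfies $$\mathcal V'\ \le\ \sum_{i=1}^m\frac{f(|S_i|)}{|S_i|}\sqrt{13.6\,m\ln m},$$ where empty bins ($S_i=\emptyset$) contribute $0$ to the sum. -/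

import Mathlib

open Set MeasureTheory
open scoped ENNReal

/-- One round of the protocol: the labeled example `(x, y)` together with the threshold `τ`
that was used in that round. -/
abbrev Round (X Y : Type*) : Type _ := (X × Y) × ℝ

/-- The data of all past rounds, the most recent round first. -/
abbrev History (X Y : Type*) : Type _ := List (Round X Y)

/-- A (possibly online-updated) conformity score function: after the past `h`, the score function
of the next round is `s h : X → Y → ℝ`. -/
abbrev ScoreFunctions (X Y : Type*) : Type _ := History X Y → X → Y → ℝ

/-- A learner maps the past to a distribution over the threshold of the next conformal predictor;
together with the score function of the round, the threshold determines the predictor. -/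
abbrev Learner (X Y : Type*) : Type _ := History X Y → Measure ℝ

/-- The conformal predictor with score function `s` and threshold `τ`. -/
def predictionSet {X Y : Type*} (s : X → Y → ℝ) (τ : ℝ) (x : X) : Set Y :=
  {y | s x y ≥ τ}

open Classical in
/-- `Miscover(C, x, y)`: the indicator of `y ∉ C x`. -/
noncomputable def miscover {X Y : Type*} (C : X → Set Y) (x : X) (y : Y) : ℝ :=
  if y ∉ C x then 1 else 0

/-- The number of miscovered rounds of a history. -/
noncomputable def totalMiscover {X Y : Type*} (s : ScoreFunctions X Y) : History X Y → ℝ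
  | [] => 0
  | z :: h => miscover (predictionSet (s h) z.2) z.1.1 z.1.2 + totalMiscover s h

/-! ### The miscoverage value -/

/-- Expectation of an arbitrary nonnegative function (outer integral); for a measurable function
it is the usual integral. It is used because a supremum of expectations over an uncountable
family of distributions need not depend measurably on the past. -/
noncomputable def outerExpectation {Ω : Type*} [MeasurableSpace Ω] (μ : Measure Ω)
    (F : Ω → ℝ≥0∞) : ℝ≥0∞ :=
  ⨅ (g : Ω → ℝ≥0∞) (_ : Measurable g) (_ : ∀ ω, F ω ≤ g ω), ∫⁻ ω, g ω ∂μ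

/-- With `k` rounds to go after the past `h`:
`sup_p E_{(X, Y) ∼ p, τ ∼ L(h)} sup_p E … payoff`. In each round the data distribution `p` is
chosen in the class `P h`, knowing the past, and `(X, Y)` and `τ` are drawn independently. -/
noncomputable def gameValue {X Y : Type*} [MeasurableSpace X] [MeasurableSpace Y]
    (P : History X Y → Set (Measure (X × Y))) (L : Learner X Y)
    (payoff : History X Y → ℝ≥0∞) : ℕ → History X Y → ℝ≥0∞
  | 0, h => payoff h
  | k + 1, h => ⨆ p ∈ P h, outerExpectation (p.prod (L h))
      (fun z => gameValue P L payoff k (z :: h))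

/-- The miscoverage value `V'` of a learner: the value of the `T`-round game with payoff
`|(1/T) ∑ₜ Miscover(Cₜ, Xₜ, Yₜ) - α|`. -/
noncomputable def miscoverageValue {X Y : Type*} [MeasurableSpace X] [MeasurableSpace Y]
    (P : History X Y → Set (Measure (X × Y))) (s : ScoreFunctions X Y)
    (T : ℕ) (α : ℝ) (L : Learner X Y) : ℝ≥0∞ :=
  gameValue P L (fun h => ENNReal.ofReal |1 / (T : ℝ) * totalMiscover s h - α|) T []

/-- A distribution on scores is smooth (at scale `w`, with parameter `ρ`) if every interval of
length at most `w` has probability at most `ρ`. -/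
def IsSmooth (ν : Measure ℝ) (w ρ : ℝ) : Prop :=
  ∀ a b : ℝ, b - a ≤ w → ν (Icc a b) ≤ ENNReal.ofReal ρ

/-- The probability distributions on `X × Y` for which the law of the score of the next round
is smooth. -/
def smoothDistributions {X Y : Type*} [MeasurableSpace X] [MeasurableSpace Y]
    (s : ScoreFunctions X Y) (w ρ : ℝ) (h : History X Y) : Set (Measure (X × Y)) :=
  {p | IsProbabilityMeasure p ∧ IsSmooth (p.map fun z => s h z.1 z.2) w ρ}

/-! ### The single-group MVP learner -/

/-- `f(n) = √((n+1) log₂²(n+2))`. -/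
noncomputable def fMVP (n : ℕ) : ℝ :=
  Real.sqrt (((n : ℝ) + 1) * (Real.logb 2 ((n : ℝ) + 2)) ^ 2)

/-- The bins of `[0, τmax]`, indexed by `i = 0, …, m - 1`; the last one is closed. -/
def bin (τmax : ℝ) (m i : ℕ) : Set ℝ :=
  if i + 1 < m then Ico (τmax * ((i : ℝ) / m)) (τmax * (((i : ℝ) + 1) / m))
  else Icc (τmax * ((i : ℝ) / m)) τmax

open Classical in
/-- The counter `nᵢ`: number of past rounds whose threshold is in bin `i`. -/
noncomputable def binCount {X Y : Type*} (τmax : ℝ) (m : ℕ) : History X Y → ℕ → ℕ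
  | [], _ => 0
  | z :: h, i => binCount τmax m h i + if z.2 ∈ bin τmax m i then 1 else 0

open Classical in
/-- The counter `vᵢ`: sum of `α - err` over the past rounds whose threshold is in bin `i`. -/
noncomputable def binBias {X Y : Type*} (s : ScoreFunctions X Y) (α τmax : ℝ) (m : ℕ) :
    History X Y → ℕ → ℝ
  | [], _ => 0
  | z :: h, i => binBias s α τmax m h i +
      if z.2 ∈ bin τmax m i then
        α - miscover (predictionSet (s h) z.2) z.1.1 z.1.2
      else 0

/-- The weight `wᵢ = exp(η vᵢ / f(nᵢ)) - exp(-η vᵢ / f(nᵢ))`. -/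
noncomputable def mvpWeight {X Y : Type*} (s : ScoreFunctions X Y) (α η τmax : ℝ) (m : ℕ)
    (h : History X Y) (i : ℕ) : ℝ :=
  Real.exp (η * binBias s α τmax m h i / fMVP (binCount τmax m h i)) -
    Real.exp (-(η * binBias s α τmax m h i / fMVP (binCount τmax m h i)))

/-- The probability `|wᵢ| / (|wᵢ| + |wᵢ₋₁|)`, with `0 / 0 = 1`, of the lower threshold. -/
noncomputable def mvpProb (w : ℕ → ℝ) (i : ℕ) : ℝ :=
  if |w i| + |w (i - 1)| = 0 then 1 else |w i| / (|w i| + |w (i - 1)|)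

open Classical in
/-- The distribution of the next threshold, given the weights: at the first `i ∈ {1, …, m - 1}`
with `wᵢ wᵢ₋₁ ≤ 0`, randomize between a point of bin `i - 1` just below the boundary of the
bins `i - 1` and `i`, and that boundary, which is in bin `i`; if there is no such `i`, take
`τmax` or `0`, according to the common sign of the weights. -/
noncomputable def mvpLaw (τmax r : ℝ) (m : ℕ) (w : ℕ → ℝ) : Measure ℝ :=
  if hex : ∃ i, 1 ≤ i ∧ i < m ∧ w i * w (i - 1) ≤ 0 then
    ENNReal.ofReal (mvpProb w (Nat.find hex)) •
        Measure.dirac (τmax * ((Nat.find hex : ℝ) / m - 1 / (r * m))) +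
      ENNReal.ofReal (1 - mvpProb w (Nat.find hex)) •
        Measure.dirac (τmax * ((Nat.find hex : ℝ) / m))
  else if ∃ i < m, 0 < w i then Measure.dirac τmax
  else Measure.dirac 0

/-- The MVP learner with target miscoverage `α`, learning rate `η`, `m` bins of `[0, τmax]`,
resolution `r` and first threshold `τ₁`. -/
noncomputable def mvpLearner {X Y : Type*} (s : ScoreFunctions X Y) (α η τmax r τ₁ : ℝ) (m : ℕ) :
    Learner X Y
  | [] => Measure.dirac τ₁
  | z :: h => mvpLaw τmax r m (mvpWeight s α η τmax m (z :: h))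

/-- `z` is a possible course of events for the learner `L`: each threshold that occurs in it is
played by `L` with positive probability. -/
def IsRun {X Y : Type*} (L : Learner X Y) : History X Y → Prop
  | [] => True
  | z :: h => L h {z.2} ≠ 0 ∧ IsRun L h

open Classical in
/-- The set `Sᵢ` of the rounds of `z` whose threshold is in bin `i`. -/
noncomputable def roundsInBin {X Y : Type*} (τmax : ℝ) (m : ℕ) (z : History X Y) (i : ℕ) :
    Finset (Fin z.length) :=
  Finset.univ.filter fun t => (z.get t).2 ∈ bin τmax m i

/-! ### Hyperbolic functions -/

/-! The proof is a potential argument. A bin with count `n` and bias `v` gets the potential `a *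
(cosh (η v / a) - 1)`, `a = fMVP n`, whose derivative in `v` is `η / 2` times the learner's weight.
Playing the bin changes this by the first-order term plus `2 η² / a`: the growth of `a` with `n`
shrinks the potential enough to pay for the rest of the second-order term (`binPotential_add_le`).
After division by `2 η²` the error `1 / fMVP n` is absorbed by the compensator `-2 √n`
(`binPotential_fMVP_succ_le`).

The learner's randomization cancels the expected first-order term up to the score mass between the
two thresholds, at most `ρ` (`exists_mvpLaw_eq`). Backward induction then bounds the game value by
the initial compensated potential `2 √(m T)`, the final cost and a multiple of `ρ`
(`gameValue_mvpLearner_le`). The final cost comes from `|v| ≤ v² / (4 a) + a`, where dividing by `2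
η²` has removed `η`; summing `a` over bins gives `√(m (T + m)) log₂ (T + 2)`.

For the right-hand side one occupied bin is enough: `fMVP n / n` decreases, so that bin contributes
at least its value at `n = T`. If `T < m`, this already exceeds the trivial bound `1` on the value;
if `m ≤ T`, it exceeds the potential bound because `9 ≤ 13.6 log 2`. -/

theorem cosh_mul_sub_one_le {c : ℝ} (hc0 : 0 ≤ c) (hc1 : c ≤ 1) (x : ℝ) :
    Real.cosh (c * x) - 1 ≤ c ^ 2 * (Real.cosh x - 1) := by
  have h1 := (hasSum_nat_add_iff' 1).mpr (Real.hasSum_cosh (c * x))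
  have h2 := ((hasSum_nat_add_iff' 1).mpr (Real.hasSum_cosh x)).mul_left (c ^ 2)
  simp only [Finset.sum_range_one, mul_zero, pow_zero, Nat.factorial_zero, Nat.cast_one,
    div_one] at h1 h2
  -- Compare the power series termwise: every exponent after the constant term is at least 2.
  refine hasSum_le (fun n => ?_) h1 h2
  rw [← mul_div_assoc, mul_pow]
  have hx : 0 ≤ x ^ (2 * (n + 1)) := (even_two_mul _).pow_nonneg x
  have hc : c ^ (2 * (n + 1)) ≤ c ^ 2 := pow_le_pow_of_le_one hc0 hc1 (by omega)
  gcongr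

theorem cosh_add_le {ε : ℝ} (hε : |ε| ≤ 1) (u : ℝ) :
    Real.cosh (u + ε) ≤ Real.cosh u + ε * Real.sinh u + ε ^ 2 * Real.cosh u := by
  have h1 := (abs_le.mp (Real.abs_exp_sub_one_sub_id_le hε)).2
  have h2 := (abs_le.mp (Real.abs_exp_sub_one_sub_id_le (x := -ε) (by simpa using hε))).2
  rw [Real.cosh_eq, Real.cosh_eq, Real.sinh_eq, neg_add, Real.exp_add, Real.exp_add]
  nlinarith [mul_le_mul_of_nonneg_left h1 (Real.exp_pos u).le,
    mul_le_mul_of_nonneg_left h2 (Real.exp_pos (-u)).le]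

theorem sq_le_two_mul_cosh_sub_one (u : ℝ) : u ^ 2 ≤ 2 * (Real.cosh u - 1) := by
  have h1 := (hasSum_nat_add_iff' 1).mpr (Real.hasSum_cosh u)
  simp only [Finset.sum_range_one, mul_zero, pow_zero, Nat.factorial_zero, Nat.cast_one,
    div_one] at h1
  have := le_hasSum h1 0 fun n _ => div_nonneg ((even_two_mul _).pow_nonneg u) (by positivity)
  norm_num at this
  linarith

/-- AM-GM, using `sinh² = (cosh - 1)(cosh + 1)`. It lets a fraction of `cosh u - 1` absorb a linear
term in `sinh u`. -/
theorem mul_abs_sinh_le (e u : ℝ) :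
    e * |Real.sinh u| ≤ (e ^ 2 + 1 / 4) * (Real.cosh u - 1) + 2 * e ^ 2 := by
  have hc := Real.one_le_cosh u
  have hs : |Real.sinh u| ^ 2 = (Real.cosh u - 1) * (Real.cosh u + 1) := by
    rw [sq_abs, Real.sinh_sq]; ring
  have hp : 0 < Real.cosh u + 1 := by linarith
  have : 0 ≤ (e * (Real.cosh u + 1) - |Real.sinh u| / 2) ^ 2 := sq_nonneg _
  have h2 : (Real.cosh u + 1) * (e * |Real.sinh u|) ≤
      (Real.cosh u + 1) * ((e ^ 2 + 1 / 4) * (Real.cosh u - 1) + 2 * e ^ 2) := by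
    nlinarith
  exact le_of_mul_le_mul_left h2 hp

/-! ### The potential of a bin -/

/-- The potential of a bin with normalization `a` and bias `v`; its derivative in the bias is
proportional to the weight of the bin. -/
noncomputable def binPotential (η a v : ℝ) : ℝ := a * (Real.cosh (η * v / a) - 1)

theorem binPotential_nonneg {a : ℝ} (ha : 0 ≤ a) (η v : ℝ) : 0 ≤ binPotential η a v :=
  mul_nonneg ha (sub_nonneg.mpr (Real.one_le_cosh _))

/-- The factor `1 / (2 η²)` is chosen so that the lower bound is free of `η`. -/
theorem sq_le_binPotential {η a : ℝ} (hη : 0 < η) (ha : 0 < a) (v : ℝ) :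
    v ^ 2 / (4 * a) ≤ binPotential η a v / (2 * η ^ 2) := by
  have h := sq_le_two_mul_cosh_sub_one (η * v / a)
  rw [binPotential, div_le_div_iff₀ (by positivity) (by positivity)]
  have h2 : a ^ 2 * (η * v / a) ^ 2 = η ^ 2 * v ^ 2 := by field_simp
  nlinarith [mul_le_mul_of_nonneg_left h (sq_nonneg a)]

theorem abs_le_binPotential_add {η a : ℝ} (hη : 0 < η) (ha : 0 < a) (v : ℝ) :
    |v| ≤ binPotential η a v / (2 * η ^ 2) + a := by
  refine le_trans ?_ (add_le_add_left (sq_le_binPotential hη ha v) a)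
  rw [← sub_nonneg]
  have : v ^ 2 / (4 * a) + a - |v| = (|v| - 2 * a) ^ 2 / (4 * a) := by
    rw [← sq_abs v]; field_simp; ring
  rw [this]
  positivity

/-- Raising the normalization from `a` to `b` multiplies the potential by at most `1 - γ`, `γ = 1 -
a / b`. The gain `γ (cosh u - 1)` covers the part of the quadratic error that grows with `u`; a
constant remains. -/
theorem binPotential_add_le {η a b δ : ℝ} (hη : 0 < η) (ha : 1 ≤ a) (hη4 : η ≤ 1 / 4)
    (hab : a ≤ b) (hgap : η ^ 2 / a ^ 2 ≤ (1 - a / b) / 2) (hδ : |δ| ≤ 1) (v : ℝ) :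
    binPotential η b (v + δ) ≤
      binPotential η a v + η * δ * Real.sinh (η * v / a) + 2 * η ^ 2 / a := by
  have ha0 : 0 < a := by linarith
  have hb0 : 0 < b := by linarith
  set u := η * v / a with hu
  set ε := η * δ / a with hε
  set e := η / a with he
  set γ := 1 - a / b with hγ
  have hc1 : a / b ≤ 1 := (div_le_one hb0).mpr hab
  have hc0 : 0 ≤ a / b := by positivity
  have he0 : 0 ≤ e := by positivity
  have he4 : e ≤ 1 / 4 := (div_le_self hη.le ha).trans hη4
  have hεe : |ε| ≤ e := by
    rw [hε, abs_div, abs_mul, abs_of_pos hη, abs_of_pos ha0, he]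
    gcongr
    exact mul_le_of_le_one_right hη.le hδ
  have hee : e ^ 2 ≤ γ / 2 := by rw [he, div_pow]; exact hgap
  have h1 : η * (v + δ) / b = a / b * (u + ε) := by rw [hu, hε]; field_simp
  have h2 : binPotential η b (v + δ) ≤ a * ((1 - γ) * (Real.cosh (u + ε) - 1)) := by
    rw [binPotential, h1]
    calc b * (Real.cosh (a / b * (u + ε)) - 1)
        ≤ b * ((a / b) ^ 2 * (Real.cosh (u + ε) - 1)) := by
          gcongr; exact cosh_mul_sub_one_le hc0 hc1 _
      _ = a * ((1 - γ) * (Real.cosh (u + ε) - 1)) := by rw [hγ]; field_simp; ring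
  have h3 : (1 - γ) * (Real.cosh (u + ε) - 1) ≤
      (Real.cosh u - 1) + ε * Real.sinh u + 2 * e ^ 2 := by
    have hγ0 : 0 ≤ γ := by rw [hγ]; linarith
    have hγ1 : γ ≤ 1 := by rw [hγ]; linarith
    have hc := Real.one_le_cosh u
    have k1 := cosh_add_le (hεe.trans (he4.trans (by norm_num))) u
    have k2 := mul_abs_sinh_le e u
    have k3 : -(ε * Real.sinh u) ≤ e * |Real.sinh u| := by
      refine (neg_le_abs _).trans ?_
      rw [abs_mul]
      gcongr
    have k4 : ε ^ 2 ≤ e ^ 2 := by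
      rw [← sq_abs]; gcongr
    have k5 : ε ^ 2 * Real.cosh u ≤ e ^ 2 * Real.cosh u := by gcongr
    have k6 : e ^ 2 ≤ 1 / 16 := by nlinarith
    have k7 : (1 - γ) * (Real.cosh (u + ε) - 1) ≤
        (1 - γ) * (Real.cosh u + ε * Real.sinh u + e ^ 2 * Real.cosh u - 1) := by
      gcongr; linarith
    have k8 : γ * (-(ε * Real.sinh u)) ≤
        γ * ((e ^ 2 + 1 / 4) * (Real.cosh u - 1) + 2 * e ^ 2) := by
      gcongr; exact k3.trans k2
    -- A quarter of the gain `γ (cosh u - 1)` goes to the linear term rescaled by `γ`; the other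
    -- three quarters outweigh `e² (cosh u - 1)` because `e² ≤ γ / 2`.
    have k9 : 0 ≤ (Real.cosh u - 1) * (γ * (3 / 4) - e ^ 2) :=
      mul_nonneg (by linarith) (by linarith)
    have k10 : 0 ≤ e ^ 2 * (1 - γ) := mul_nonneg (sq_nonneg e) (by linarith)
    nlinarith
  have h4 : a * ((Real.cosh u - 1) + ε * Real.sinh u + 2 * e ^ 2) =
      binPotential η a v + η * δ * Real.sinh u + 2 * η ^ 2 / a := by
    rw [binPotential, ← hu, hε, he]; field_simp
  exact h2.trans (h4 ▸ mul_le_mul_of_nonneg_left h3 ha0.le)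

/-! ### The normalization `fMVP` -/

theorem one_le_logb_two_add (n : ℕ) : 1 ≤ Real.logb 2 ((n : ℝ) + 2) := by
  rw [Real.le_logb_iff_rpow_le (by norm_num) (by positivity)]
  simp

theorem fMVP_eq (n : ℕ) : fMVP n = Real.sqrt ((n : ℝ) + 1) * Real.logb 2 ((n : ℝ) + 2) := by
  rw [fMVP, Real.sqrt_mul (by positivity),
    Real.sqrt_sq (zero_le_one.trans (one_le_logb_two_add n))]

theorem sqrt_le_fMVP (n : ℕ) : Real.sqrt ((n : ℝ) + 1) ≤ fMVP n := by
  rw [fMVP_eq]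
  exact le_mul_of_one_le_right (Real.sqrt_nonneg _) (one_le_logb_two_add n)

theorem one_le_fMVP (n : ℕ) : 1 ≤ fMVP n :=
  (Real.one_le_sqrt.mpr (by simp)).trans (sqrt_le_fMVP n)

/-- The square root alone grows this fast: with `k = n + 2`, `(1 - 1 / (2k))² k = k - 1 + 1 / (4k)`.
The logarithm only helps. -/
theorem fMVP_le_succ (n : ℕ) :
    fMVP n ≤ (1 - 1 / (2 * ((n : ℝ) + 2))) * fMVP (n + 1) := by
  rw [fMVP_eq, fMVP_eq]
  have h0 := one_le_logb_two_add n
  have hl : Real.logb 2 ((n : ℝ) + 2) ≤ Real.logb 2 (((n + 1 : ℕ) : ℝ) + 2) := by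
    apply Real.logb_le_logb_of_le (by norm_num) (by positivity)
    push_cast; linarith
  have hc : 0 ≤ 1 - 1 / (2 * ((n : ℝ) + 2)) := by
    rw [sub_nonneg, div_le_one (by positivity)]
    have : (0 : ℝ) ≤ n := n.cast_nonneg
    linarith
  have hs : Real.sqrt ((n : ℝ) + 1) ≤
      (1 - 1 / (2 * ((n : ℝ) + 2))) * Real.sqrt (((n + 1 : ℕ) : ℝ) + 1) := by
    apply Real.sqrt_le_iff.mpr
    refine ⟨by positivity, ?_⟩
    rw [mul_pow, Real.sq_sqrt (by positivity)]
    have : (1 - 1 / (2 * ((n : ℝ) + 2))) ^ 2 * (((n + 1 : ℕ) : ℝ) + 1) =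
        n + 1 + 1 / (4 * ((n : ℝ) + 2)) := by
      push_cast; field_simp; ring
    rw [this]
    have : (0 : ℝ) ≤ 1 / (4 * ((n : ℝ) + 2)) := by positivity
    linarith
  rw [← mul_assoc]
  gcongr

theorem fMVP_pos (n : ℕ) : 0 < fMVP n := zero_lt_one.trans_le (one_le_fMVP n)

theorem fMVP_gap {η : ℝ} (hη : 0 < η) (hη4 : η ≤ 1 / 4) (n : ℕ) :
    η ^ 2 / fMVP n ^ 2 ≤ (1 - fMVP n / fMVP (n + 1)) / 2 := by
  have hn : (0 : ℝ) ≤ n := n.cast_nonneg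
  have h1 : fMVP n / fMVP (n + 1) ≤ 1 - 1 / (2 * ((n : ℝ) + 2)) :=
    (div_le_iff₀ (fMVP_pos _)).mpr (fMVP_le_succ n)
  have h2 : (n : ℝ) + 1 ≤ fMVP n ^ 2 := by
    rw [← Real.sqrt_le_left (fMVP_pos n).le]
    exact sqrt_le_fMVP n
  have h3 : η ^ 2 / fMVP n ^ 2 ≤ (1 / 16) / ((n : ℝ) + 1) := by
    gcongr; nlinarith
  have h4 : (1 / 16) / ((n : ℝ) + 1) ≤ 1 / (4 * ((n : ℝ) + 2)) := by
    rw [div_le_div_iff₀ (by positivity) (by positivity)]; linarith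
  have h5 : (1 : ℝ) / (2 * ((n : ℝ) + 2)) / 2 = 1 / (4 * ((n : ℝ) + 2)) := by
    field_simp; norm_num
  linarith

theorem inv_fMVP_le (n : ℕ) :
    1 / fMVP n ≤ 2 * Real.sqrt ((n + 1 : ℕ) : ℝ) - 2 * Real.sqrt (n : ℝ) := by
  push_cast
  set x := Real.sqrt ((n : ℝ) + 1) with hx
  set y := Real.sqrt (n : ℝ) with hy
  have hx0 : 0 < x := Real.sqrt_pos.mpr (by positivity)
  have hy0 : 0 ≤ y := Real.sqrt_nonneg _
  have hxy : y ≤ x := Real.sqrt_le_sqrt (by linarith)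
  have hd : x ^ 2 - y ^ 2 = 1 := by
    rw [hx, hy, Real.sq_sqrt (by positivity), Real.sq_sqrt (by positivity)]; ring
  refine (one_div_le_one_div_of_le hx0 (sqrt_le_fMVP n)).trans ?_
  rw [div_le_iff₀ hx0]
  nlinarith

theorem binPotential_fMVP_succ_le {η δ : ℝ} (hη : 0 < η) (hη4 : η ≤ 1 / 4) (hδ : |δ| ≤ 1)
    (n : ℕ) (v : ℝ) :
    binPotential η (fMVP (n + 1)) (v + δ) / (2 * η ^ 2) - 2 * Real.sqrt ((n + 1 : ℕ) : ℝ) ≤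
      binPotential η (fMVP n) v / (2 * η ^ 2) - 2 * Real.sqrt (n : ℝ) +
        2 * Real.sinh (η * v / fMVP n) * δ / (4 * η) := by
  have hle : fMVP n ≤ fMVP (n + 1) := by
    refine (fMVP_le_succ n).trans (mul_le_of_le_one_left (fMVP_pos _).le ?_)
    have : (0 : ℝ) ≤ 1 / (2 * ((n : ℝ) + 2)) := by positivity
    linarith
  have h := binPotential_add_le hη (one_le_fMVP n) hη4 hle (fMVP_gap hη hη4 n) hδ v
  have h2 := div_le_div_of_nonneg_right h (show 0 ≤ 2 * η ^ 2 by positivity)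
  have hf := fMVP_pos n
  have h3 : (binPotential η (fMVP n) v + η * δ * Real.sinh (η * v / fMVP n) +
      2 * η ^ 2 / fMVP n) / (2 * η ^ 2) = binPotential η (fMVP n) v / (2 * η ^ 2) +
        2 * Real.sinh (η * v / fMVP n) * δ / (4 * η) + 1 / fMVP n := by
    generalize Real.sinh (η * v / fMVP n) = S
    field_simp
    ring
  linarith [inv_fMVP_le n]

/-- The product of `√(n+2) √n ≤ n + 1` and `log (n+3) √n ≤ log (n+2) √(n+1)`. -/
theorem fMVP_div_succ_le {n : ℕ} (hn : 1 ≤ n) :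
    fMVP (n + 1) / ((n + 1 : ℕ) : ℝ) ≤ fMVP n / (n : ℝ) := by
  have hn' : (1 : ℝ) ≤ n := by exact_mod_cast hn
  have hn0 : (0 : ℝ) < n := by linarith
  rw [fMVP_eq, fMVP_eq]
  push_cast
  set x := Real.sqrt (n : ℝ)
  set y := Real.sqrt ((n : ℝ) + 1) with hy
  set z := Real.sqrt ((n : ℝ) + 1 + 1)
  have hx : x ^ 2 = n := Real.sq_sqrt hn0.le
  have hy2 : y ^ 2 = n + 1 := Real.sq_sqrt (by positivity)
  have hz : z ^ 2 = n + 1 + 1 := Real.sq_sqrt (by positivity)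
  have hx0 : 0 < x := Real.sqrt_pos.mpr hn0
  have hy0 : 0 < y := Real.sqrt_pos.mpr (by positivity)
  have hz0 : 0 ≤ z := Real.sqrt_nonneg _
  have hzx : z * x ≤ y ^ 2 := by
    refine abs_le_of_sq_le_sq' ?_ (by positivity) |>.2
    rw [mul_pow, hz, hx, hy2]; nlinarith
  have hlog2 : 0 < Real.log 2 := Real.log_pos (by norm_num)
  have hl2 := Real.log_two_gt_d9
  -- The left side is `(2n + 1) / (n + 2)`, exactly what is needed below after `2 x y ≤ x² + y² = 2n
  -- + 1`. Expanding the logarithm at 4 is accurate enough from `n = 1` on.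
  have hlog : 2 - 3 / ((n : ℝ) + 2) ≤ Real.log ((n : ℝ) + 2) := by
    have h1 := Real.one_sub_inv_le_log_of_pos (show 0 < ((n : ℝ) + 2) / 4 by positivity)
    rw [Real.log_div (by positivity) (by norm_num), inv_div,
      show (4 : ℝ) = 2 ^ 2 by norm_num, Real.log_pow] at h1
    have h2 : 1 / ((n : ℝ) + 2) ≤ 1 / 3 := one_div_le_one_div_of_le (by norm_num) (by linarith)
    have h3 : (2 : ℝ) ^ 2 / (n + 2) = 4 * (1 / (n + 2)) := by ring
    have h4 : (3 : ℝ) / (n + 2) = 3 * (1 / (n + 2)) := by ring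
    push_cast at h1
    rw [h3] at h1
    rw [h4]
    linarith
  have hstep : Real.log ((n : ℝ) + 1 + 2) ≤ Real.log ((n : ℝ) + 2) + 1 / ((n : ℝ) + 2) := by
    have h1 := Real.log_le_sub_one_of_pos (show 0 < ((n : ℝ) + 1 + 2) / (n + 2) by positivity)
    rw [Real.log_div (by positivity) (by positivity)] at h1
    have : ((n : ℝ) + 1 + 2) / (n + 2) - 1 = 1 / ((n : ℝ) + 2) := by field_simp; ring
    linarith
  have key : Real.log ((n : ℝ) + 1 + 2) * x ≤ Real.log ((n : ℝ) + 2) * y := by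
    have hd : 1 / (2 * y) ≤ y - x := by
      rw [div_le_iff₀ (by positivity)]
      nlinarith [sq_nonneg (y - x)]
    have hl0 : 0 ≤ Real.log ((n : ℝ) + 2) := Real.log_nonneg (by linarith)
    have h2 : x / ((n : ℝ) + 2) ≤ Real.log ((n : ℝ) + 2) * (1 / (2 * y)) := by
      rw [mul_one_div, div_le_div_iff₀ (by positivity) (by positivity)]
      have : (2 - 3 / ((n : ℝ) + 2)) * (n + 2) ≤ Real.log ((n : ℝ) + 2) * (n + 2) := by gcongr
      have h5 : (2 - 3 / ((n : ℝ) + 2)) * (n + 2) = 2 * n + 1 := by field_simp; ring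
      nlinarith [sq_nonneg (y - x)]
    calc Real.log ((n : ℝ) + 1 + 2) * x
        ≤ (Real.log ((n : ℝ) + 2) + 1 / ((n : ℝ) + 2)) * x := by gcongr
      _ = Real.log ((n : ℝ) + 2) * x + x / ((n : ℝ) + 2) := by ring
      _ ≤ Real.log ((n : ℝ) + 2) * x + Real.log ((n : ℝ) + 2) * (y - x) := by
          gcongr; exact h2.trans (by gcongr)
      _ = _ := by ring
  have key2 : Real.logb 2 ((n : ℝ) + 1 + 2) * x ≤ Real.logb 2 ((n : ℝ) + 2) * y := by
    rw [Real.logb, Real.logb, div_mul_eq_mul_div, div_mul_eq_mul_div]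
    gcongr
  rw [div_le_div_iff₀ (by positivity) (by positivity)]
  have hlb : 0 ≤ Real.logb 2 ((n : ℝ) + 2) := zero_le_one.trans (one_le_logb_two_add n)
  have : z * x * (Real.logb 2 ((n : ℝ) + 1 + 2) * x) ≤
      y ^ 2 * (Real.logb 2 ((n : ℝ) + 2) * y) := by
    have := one_le_logb_two_add (n + 1)
    push_cast at this
    have : 0 ≤ Real.logb 2 ((n : ℝ) + 1 + 2) := by linarith
    gcongr
  rw [← hx, ← hx, ← hy2] at *
  nlinarith

theorem fMVP_div_antitone {n k : ℕ} (hn : 1 ≤ n) (hk : n ≤ k) :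
    fMVP k / (k : ℝ) ≤ fMVP n / (n : ℝ) := by
  induction k, hk using Nat.le_induction with
  | base => exact le_rfl
  | succ k hk ih => exact (fMVP_div_succ_le (hn.trans hk)).trans ih

/-! ### Bins and counters along a history -/

theorem bin_unique {τmax τ : ℝ} {m i j : ℕ} (hτ : 0 < τmax) (hi : i < m) (hj : j < m)
    (h1 : τ ∈ bin τmax m i) (h2 : τ ∈ bin τmax m j) : i = j := by
  have key : ∀ {i j : ℕ}, i < j → j < m → τ ∈ bin τmax m i → τ ∈ bin τmax m j → False := by
    intro i j hij hj h1 h2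
    have hm : (0 : ℝ) < m := by exact_mod_cast (Nat.zero_le j).trans_lt hj
    rw [bin, if_pos (by omega)] at h1
    have h3 : τmax * ((j : ℝ) / m) ≤ τ := by
      rw [bin] at h2
      split_ifs at h2
      exacts [h2.1, h2.1]
    have h4 : τmax * (((i : ℝ) + 1) / m) ≤ τmax * ((j : ℝ) / m) := by
      have : (i : ℝ) + 1 ≤ j := by exact_mod_cast hij
      gcongr
    linarith [h1.2]
  rcases lt_trichotomy i j with h | h | h
  exacts [(key h hj h1 h2).elim, h, (key h hi h2 h1).elim]

/-- Every threshold of the history lies in one of the bins. -/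
def InBins {X Y : Type*} (τmax : ℝ) (m : ℕ) (h : History X Y) : Prop :=
  ∀ z ∈ h, ∃ i < m, z.2 ∈ bin τmax m i

theorem miscover_nonneg {X Y : Type*} (C : X → Set Y) (x : X) (y : Y) : 0 ≤ miscover C x y := by
  rw [miscover]; split_ifs <;> norm_num

theorem miscover_le_one {X Y : Type*} (C : X → Set Y) (x : X) (y : Y) : miscover C x y ≤ 1 := by
  rw [miscover]; split_ifs <;> norm_num

section

variable {X Y : Type*} {s : ScoreFunctions X Y} {α η τmax : ℝ} {m : ℕ}

theorem binCount_cons {h : History X Y} {z : Round X Y} {i j : ℕ} (hτ : 0 < τmax) (hi : i < m)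
    (hj : j < m) (hz : z.2 ∈ bin τmax m j) :
    binCount τmax m (z :: h) i = binCount τmax m h i + if i = j then 1 else 0 := by
  have : z.2 ∈ bin τmax m i ↔ i = j :=
    ⟨fun h1 => bin_unique hτ hi hj h1 hz, fun h1 => h1 ▸ hz⟩
  simp [binCount, this]

theorem binBias_cons {h : History X Y} {z : Round X Y} {i j : ℕ} (hτ : 0 < τmax) (hi : i < m)
    (hj : j < m) (hz : z.2 ∈ bin τmax m j) :
    binBias s α τmax m (z :: h) i = binBias s α τmax m h i +
      if i = j then α - miscover (predictionSet (s h) z.2) z.1.1 z.1.2 else 0 := by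
  have : z.2 ∈ bin τmax m i ↔ i = j :=
    ⟨fun h1 => bin_unique hτ hi hj h1 hz, fun h1 => h1 ▸ hz⟩
  simp [binBias, this]

theorem sum_binCount (hτ : 0 < τmax) {h : History X Y} (hh : InBins τmax m h) :
    ∑ i ∈ Finset.range m, binCount τmax m h i = h.length := by
  induction h with
  | nil => simp [binCount]
  | cons z h ih =>
    obtain ⟨j, hj, hz⟩ := hh z (by simp)
    rw [Finset.sum_congr rfl fun i hi =>
      binCount_cons (h := h) hτ (Finset.mem_range.mp hi) hj hz]
    rw [Finset.sum_add_distrib, ih fun z' hz' => hh z' (by simp [hz'])]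
    simp [hj]

theorem sum_binBias (hτ : 0 < τmax) {h : History X Y} (hh : InBins τmax m h) :
    ∑ i ∈ Finset.range m, binBias s α τmax m h i = α * h.length - totalMiscover s h := by
  induction h with
  | nil => simp [binBias, totalMiscover]
  | cons z h ih =>
    obtain ⟨j, hj, hz⟩ := hh z (by simp)
    rw [Finset.sum_congr rfl fun i hi =>
      binBias_cons (h := h) hτ (Finset.mem_range.mp hi) hj hz]
    rw [Finset.sum_add_distrib, ih fun z' hz' => hh z' (by simp [hz'])]
    simp [hj, totalMiscover]
    ring

theorem abs_sub_miscover_le_one (hα : α ∈ Icc (0 : ℝ) 1) (C : X → Set Y) (x : X) (y : Y) :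
    |α - miscover C x y| ≤ 1 :=
  abs_le.mpr ⟨by linarith [hα.1, miscover_le_one C x y],
    by linarith [hα.2, miscover_nonneg C x y]⟩

theorem abs_binBias_le (hα : α ∈ Icc (0 : ℝ) 1) (h : History X Y) (i : ℕ) :
    |binBias s α τmax m h i| ≤ h.length := by
  induction h with
  | nil => simp [binBias]
  | cons z h ih =>
    rw [binBias, List.length_cons, Nat.cast_add, Nat.cast_one]
    refine (abs_add_le _ _).trans (add_le_add ih ?_)
    split_ifs
    · exact abs_sub_miscover_le_one hα _ _ _
    · simp

theorem mvpWeight_eq (h : History X Y) (i : ℕ) :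
    mvpWeight s α η τmax m h i =
      2 * Real.sinh (η * binBias s α τmax m h i / fMVP (binCount τmax m h i)) := by
  rw [mvpWeight, Real.sinh_eq]; ring

/-- A crude bound suffices: in the drift estimate it only multiplies `ρ`, so `ρ₀` absorbs it. -/
theorem abs_mvpWeight_le (hα : α ∈ Icc (0 : ℝ) 1) (hη : 0 < η) (hη1 : η ≤ 1) (h : History X Y)
    (i : ℕ) : |mvpWeight s α η τmax m h i| ≤ Real.exp h.length := by
  have hb := abs_binBias_le (s := s) (τmax := τmax) (m := m) hα h i
  have hu : |η * binBias s α τmax m h i / fMVP (binCount τmax m h i)| ≤ h.length := by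
    rw [abs_div, abs_mul, abs_of_pos hη, abs_of_pos (fMVP_pos _)]
    refine (div_le_self (by positivity) (one_le_fMVP _)).trans ?_
    exact (mul_le_of_le_one_left (abs_nonneg _) hη1).trans hb
  rw [mvpWeight]
  generalize η * binBias s α τmax m h i / fMVP (binCount τmax m h i) = u at hu
  have h1 := Real.exp_le_exp.mpr ((le_abs_self u).trans hu)
  have h2 := Real.exp_le_exp.mpr ((neg_le_abs u).trans hu)
  exact abs_le.mpr ⟨by linarith [Real.exp_pos u], by linarith [Real.exp_pos (-u)]⟩

/-! ### The potential of a history -/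

/-- The total potential of the bins, compensated so that it has no upward drift under the
learner, and nonnegative for histories of length at most `T`. -/
noncomputable def mvpPotential (s : ScoreFunctions X Y) (α η τmax : ℝ) (m T : ℕ)
    (h : History X Y) : ℝ :=
  ∑ i ∈ Finset.range m,
    (binPotential η (fMVP (binCount τmax m h i)) (binBias s α τmax m h i) / (2 * η ^ 2) -
      2 * Real.sqrt (binCount τmax m h i : ℝ)) + 2 * Real.sqrt (m * T)

theorem mvpPotential_nil (T : ℕ) :
    mvpPotential s α η τmax m T [] = 2 * Real.sqrt (m * T) := by
  simp [mvpPotential, binCount, binBias, binPotential]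

theorem mvpPotential_cons_le {T : ℕ} {h : History X Y} {z : Round X Y} {j : ℕ} (hτ : 0 < τmax)
    (hα : α ∈ Icc (0 : ℝ) 1) (hη : 0 < η) (hη4 : η ≤ 1 / 4) (hj : j < m)
    (hz : z.2 ∈ bin τmax m j) :
    mvpPotential s α η τmax m T (z :: h) ≤ mvpPotential s α η τmax m T h +
      mvpWeight s α η τmax m h j *
        (α - miscover (predictionSet (s h) z.2) z.1.1 z.1.2) / (4 * η) := by
  rw [mvpPotential, mvpPotential, add_right_comm]
  refine add_le_add_left ?_ _
  set d := mvpWeight s α η τmax m h j *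
    (α - miscover (predictionSet (s h) z.2) z.1.1 z.1.2) / (4 * η) with hd
  have hsum : d = ∑ i ∈ Finset.range m, if i = j then d else 0 := by simp [hj]
  rw [hsum, ← Finset.sum_add_distrib]
  refine Finset.sum_le_sum fun i hi => ?_
  rw [binCount_cons hτ (Finset.mem_range.mp hi) hj hz,
    binBias_cons hτ (Finset.mem_range.mp hi) hj hz]
  by_cases hij : i = j
  · subst hij
    simp only [if_true]
    rw [hd, mvpWeight_eq]
    exact binPotential_fMVP_succ_le hη hη4 (abs_sub_miscover_le_one hα _ _ _) _ _
  · simp [hij]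

theorem sum_sqrt_le_sqrt (c : ℕ → ℝ) (hc : ∀ i, 0 ≤ c i) (m : ℕ) :
    ∑ i ∈ Finset.range m, Real.sqrt (c i) ≤ Real.sqrt (m * ∑ i ∈ Finset.range m, c i) := by
  apply Real.le_sqrt_of_sq_le
  have h := sq_sum_le_card_mul_sum_sq (s := Finset.range m) (f := fun i => Real.sqrt (c i))
  simpa [Real.sq_sqrt (hc _)] using h

theorem sum_sqrt_binCount_le (hτ : 0 < τmax) {h : History X Y} (hh : InBins τmax m h) :
    ∑ i ∈ Finset.range m, Real.sqrt (binCount τmax m h i : ℝ) ≤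
      Real.sqrt (m * h.length) := by
  refine (sum_sqrt_le_sqrt _ (fun i => Nat.cast_nonneg _) m).trans (le_of_eq ?_)
  rw [← sum_binCount hτ hh]
  push_cast
  rfl

theorem sum_binPotential_le {T : ℕ} (hτ : 0 < τmax) {h : History X Y} (hh : InBins τmax m h)
    (hT : h.length ≤ T) :
    ∑ i ∈ Finset.range m,
      binPotential η (fMVP (binCount τmax m h i)) (binBias s α τmax m h i) / (2 * η ^ 2) ≤
        mvpPotential s α η τmax m T h := by
  have h1 : Real.sqrt (m * h.length) ≤ Real.sqrt (m * T) := by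
    apply Real.sqrt_le_sqrt
    gcongr
  rw [mvpPotential, Finset.sum_sub_distrib, ← Finset.mul_sum]
  linarith [sum_sqrt_binCount_le hτ hh]

theorem mvpPotential_nonneg {T : ℕ} (hτ : 0 < τmax) {h : History X Y} (hh : InBins τmax m h)
    (hT : h.length ≤ T) : 0 ≤ mvpPotential s α η τmax m T h := by
  refine le_trans (Finset.sum_nonneg fun i _ => ?_) (sum_binPotential_le hτ hh hT)
  exact div_nonneg (binPotential_nonneg (fMVP_pos _).le _ _) (by positivity)

/-- Replace each logarithm by the one at the full length, then apply Cauchy–Schwarz to the square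
roots. -/
theorem sum_fMVP_binCount_le (hτ : 0 < τmax) {h : History X Y} (hh : InBins τmax m h) :
    ∑ i ∈ Finset.range m, fMVP (binCount τmax m h i) ≤
      Real.sqrt (m * (h.length + m)) * Real.logb 2 ((h.length : ℝ) + 2) := by
  have hle : ∀ i ∈ Finset.range m, fMVP (binCount τmax m h i) ≤
      Real.sqrt ((binCount τmax m h i : ℝ) + 1) * Real.logb 2 ((h.length : ℝ) + 2) := by
    intro i hi
    rw [fMVP_eq]
    have : binCount τmax m h i ≤ h.length :=
      sum_binCount hτ hh ▸ Finset.single_le_sum (fun _ _ => Nat.zero_le _) hi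
    gcongr
    norm_num
  refine (Finset.sum_le_sum hle).trans ?_
  rw [← Finset.sum_mul]
  refine mul_le_mul_of_nonneg_right ?_ (zero_le_one.trans (one_le_logb_two_add _))
  refine (sum_sqrt_le_sqrt _ (fun i => by positivity) m).trans (le_of_eq ?_)
  rw [← sum_binCount hτ hh, Finset.sum_add_distrib]
  push_cast
  simp

/-- The bins partition the rounds, so the total bias is the sum of the bin biases, and each is
controlled by its potential. -/
theorem abs_totalMiscover_sub_le {T : ℕ} (hτ : 0 < τmax) (hη : 0 < η) (hT : 0 < T)
    {h : History X Y} (hh : InBins τmax m h) (hl : h.length = T) :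
    |1 / (T : ℝ) * totalMiscover s h - α| ≤ (mvpPotential s α η τmax m T h +
      Real.sqrt (m * (T + m)) * Real.logb 2 ((T : ℝ) + 2)) / T := by
  have hT0 : (0 : ℝ) < T := by exact_mod_cast hT
  have h1 : 1 / (T : ℝ) * totalMiscover s h - α =
      -(∑ i ∈ Finset.range m, binBias s α τmax m h i) / T := by
    rw [sum_binBias hτ hh, hl]; field_simp; ring
  rw [h1, abs_div, abs_neg, abs_of_pos hT0]
  refine div_le_div_of_nonneg_right ?_ hT0.le
  refine (Finset.abs_sum_le_sum_abs _ _).trans ((Finset.sum_le_sum fun i _ =>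
    abs_le_binPotential_add hη (fMVP_pos (binCount τmax m h i)) _).trans ?_)
  rw [Finset.sum_add_distrib]
  refine add_le_add (sum_binPotential_le hτ hh hl.le) ?_
  have := sum_fMVP_binCount_le hτ hh
  rwa [hl] at this

end

/-! ### The law of the next threshold -/

theorem left_mem_bin {τmax : ℝ} {m i : ℕ} (hτ : 0 < τmax) (hi : i < m) :
    τmax * ((i : ℝ) / m) ∈ bin τmax m i := by
  have hm : (0 : ℝ) < m := by exact_mod_cast (Nat.zero_le i).trans_lt hi
  rw [bin]
  split_ifs with h
  · refine ⟨le_rfl, ?_⟩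
    gcongr
    linarith
  · refine ⟨le_rfl, mul_le_of_le_one_right hτ.le ((div_le_one hm).mpr ?_)⟩
    exact_mod_cast hi.le

theorem max_mem_bin {τmax : ℝ} {m : ℕ} (hτ : 0 < τmax) (hm : 0 < m) :
    τmax ∈ bin τmax m (m - 1) := by
  have hm' : (0 : ℝ) < m := by exact_mod_cast hm
  rw [bin, if_neg (by omega)]
  refine ⟨mul_le_of_le_one_right hτ.le ((div_le_one hm').mpr ?_), le_rfl⟩
  exact_mod_cast Nat.sub_le m 1

theorem below_mem_bin {τmax r : ℝ} {m i : ℕ} (hτ : 0 < τmax) (hr : 1 ≤ r) (hi1 : 1 ≤ i)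
    (hi : i < m) : τmax * ((i : ℝ) / m - 1 / (r * m)) ∈ bin τmax m (i - 1) := by
  have hm : (0 : ℝ) < m := by exact_mod_cast (Nat.zero_le i).trans_lt hi
  have hr0 : 0 < r := by linarith
  rw [bin, if_pos (by omega)]
  push_cast [hi1]
  constructor
  · have : 1 / (r * m) ≤ 1 / (m : ℝ) := one_div_le_one_div_of_le hm (by nlinarith)
    rw [sub_div]
    gcongr
  · have : 0 < 1 / (r * (m : ℝ)) := by positivity
    rw [sub_add_cancel]
    gcongr
    linarith

theorem exists_mem_bin {τmax τ : ℝ} {m : ℕ} (hτ : 0 < τmax) (hm : 0 < m)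
    (h : τ ∈ Icc 0 τmax) : ∃ i < m, τ ∈ bin τmax m i := by
  have hm' : (0 : ℝ) < m := by exact_mod_cast hm
  have hx0 : 0 ≤ τ * m / τmax := by have := h.1; positivity
  by_cases hlt : ⌊τ * m / τmax⌋₊ + 1 < m
  · refine ⟨_, Nat.lt_of_succ_lt hlt, ?_⟩
    rw [bin, if_pos hlt]
    have h1 := Nat.floor_le hx0
    have h2 := Nat.lt_floor_add_one (τ * m / τmax)
    rw [le_div_iff₀ hτ] at h1
    rw [div_lt_iff₀ hτ] at h2
    constructor
    · rw [← mul_div_assoc, div_le_iff₀ hm']; linarith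
    · rw [← mul_div_assoc, lt_div_iff₀ hm']; linarith
  · refine ⟨m - 1, by omega, ?_⟩
    rw [bin, if_neg (by omega)]
    refine ⟨?_, h.2⟩
    have h1 := Nat.floor_le hx0
    have h3 : ((m - 1 : ℕ) : ℝ) ≤ (⌊τ * m / τmax⌋₊ : ℝ) := by
      exact_mod_cast (by omega : m - 1 ≤ ⌊τ * m / τmax⌋₊)
    rw [← mul_div_assoc, div_le_iff₀ hm']
    have := h3.trans h1
    rw [le_div_iff₀ hτ] at this
    linarith

theorem mvpProb_mem (w : ℕ → ℝ) (i : ℕ) : mvpProb w i ∈ Icc (0 : ℝ) 1 := by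
  rw [mvpProb]
  split_ifs with h
  · simp
  · refine ⟨by positivity, (div_le_one (by positivity)).mpr ?_⟩
    linarith [abs_nonneg (w (i - 1))]

/-- The two weights have opposite signs, and each threshold is played with probability proportional
to the size of the other's weight. -/
theorem mvpProb_balance {w : ℕ → ℝ} {i : ℕ} (h : w i * w (i - 1) ≤ 0) :
    mvpProb w i * w (i - 1) + (1 - mvpProb w i) * w i = 0 := by
  rw [mvpProb]
  generalize w i = x at *
  generalize w (i - 1) = y at *
  split_ifs with h0
  · have : |y| = 0 := by linarith [abs_nonneg x, abs_nonneg y]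
    simp [abs_eq_zero.mp this]
  · field_simp
    rcases le_total 0 x with hx | hx <;> rcases le_total 0 y with hy | hy <;>
      simp only [abs_of_nonneg, abs_of_nonpos, hx, hy] <;> nlinarith

theorem pos_of_no_sign_change {w : ℕ → ℝ} {m i : ℕ}
    (hno : ¬∃ i, 1 ≤ i ∧ i < m ∧ w i * w (i - 1) ≤ 0) (hw : 0 < w i) {k : ℕ}
    (hik : i ≤ k) (hk : k < m) : 0 < w k := by
  push Not at hno
  induction k, hik using Nat.le_induction with
  | base => exact hw
  | succ k hik ih =>
    have h1 := hno (k + 1) (by omega) hk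
    exact (pos_iff_pos_of_mul_pos h1).mpr (ih (by omega))

/-- The learner randomizes between two thresholds, and if the miscoverage probability `q` at the
two thresholds is almost the same, then the weighted bias has almost no upward drift. -/
theorem exists_mvpLaw_eq {τmax r α ρ W : ℝ} {m : ℕ} {w : ℕ → ℝ} {q : ℝ → ℝ} (hτ : 0 < τmax)
    (hr : 1 ≤ r) (hm : 2 ≤ m) (hα : α ∈ Icc (0 : ℝ) 1) (hρ : 0 ≤ ρ)
    (hW : ∀ i, |w i| ≤ W) (hq0 : q 0 = 0) (hqm : 1 - q τmax ≤ ρ)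
    (hq : ∀ a b, a ≤ b → b - a ≤ τmax / (r * m) → q a ≤ q b ∧ q b - q a ≤ ρ) :
    ∃ (a b c : ℝ) (i j : ℕ), c ∈ Icc (0 : ℝ) 1 ∧ i < m ∧ j < m ∧ a ∈ bin τmax m i ∧
      b ∈ bin τmax m j ∧
      mvpLaw τmax r m w =
        ENNReal.ofReal c • Measure.dirac a + ENNReal.ofReal (1 - c) • Measure.dirac b ∧
      c * (w i * (α - q a)) + (1 - c) * (w j * (α - q b)) ≤ W * ρ := by
  classical
  have hm' : (0 : ℝ) < m := by exact_mod_cast (by omega : 0 < m)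
  have hr0 : 0 < r := by linarith
  rw [mvpLaw]
  split_ifs with hex hpos
  · obtain ⟨h1, h2, h3⟩ := Nat.find_spec hex
    set i := Nat.find hex
    have hc := mvpProb_mem w i
    refine ⟨_, _, _, i - 1, i, hc, by omega, h2, below_mem_bin hτ hr h1 h2, left_mem_bin hτ h2,
      rfl, ?_⟩
    have hgap := hq (τmax * ((i : ℝ) / m - 1 / (r * m))) (τmax * ((i : ℝ) / m))
      (by gcongr; linarith [show 0 < 1 / (r * (m : ℝ)) by positivity])
      (le_of_eq (by ring))
    generalize q (τmax * ((i : ℝ) / m - 1 / (r * m))) = x at hgap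
    generalize q (τmax * ((i : ℝ) / m)) = y at hgap
    have hb := mvpProb_balance h3
    generalize mvpProb w i = c at hb hc
    -- Were the two miscoverage probabilities equal, the balance would make the drift vanish; only
    -- their difference survives.
    have h4 : c * (w (i - 1) * (α - x)) + (1 - c) * (w i * (α - y)) =
        -((1 - c) * (w i * (y - x))) := by linear_combination (α - x) * hb
    rw [h4]
    refine (neg_le_abs _).trans ?_
    rw [abs_mul, abs_mul, abs_of_nonneg (by linarith [hc.2] : 0 ≤ 1 - c),
      abs_of_nonneg (by linarith : 0 ≤ y - x)]
    have h5 : |w i| * (y - x) ≤ W * ρ :=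
      mul_le_mul (hW i) hgap.2 (by linarith) ((abs_nonneg _).trans (hW i))
    refine (mul_le_of_le_one_left ?_ (by linarith [hc.1])).trans h5
    exact mul_nonneg (abs_nonneg _) (by linarith)
  -- Positivity propagates to the last bin, which contains `τmax`. There the miscoverage probability
  -- is at least `1 - ρ`, so `α - q τmax ≤ ρ`. The point mass is written as a mixture with `a = b`,
  -- `c = 1`.
  · obtain ⟨i, hi, hwi⟩ := hpos
    have hw := pos_of_no_sign_change hex hwi (k := m - 1) (by omega) (by omega)
    refine ⟨τmax, τmax, 1, m - 1, m - 1, by simp, by omega, by omega,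
      max_mem_bin hτ (by omega), max_mem_bin hτ (by omega), by simp, ?_⟩
    have h1 : w (m - 1) * (α - q τmax) ≤ w (m - 1) * ρ := by
      gcongr; linarith [hα.2]
    have h2 : w (m - 1) * ρ ≤ W * ρ := by
      gcongr; exact (le_abs_self _).trans (hW _)
    linarith
  -- Threshold 0 never miscovers, so a nonpositive weight meets a bias increment `α ≥ 0`.
  · push Not at hpos
    have hm0 : 0 < m := by omega
    have h0 : (0 : ℝ) ∈ bin τmax m 0 := by
      simpa using left_mem_bin hτ hm0
    refine ⟨0, 0, 1, 0, 0, by simp, by omega, by omega, h0, h0, by simp, ?_⟩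
    have h1 : w 0 * α ≤ 0 := mul_nonpos_of_nonpos_of_nonneg (hpos 0 (by omega)) hα.1
    have h2 : 0 ≤ W * ρ := mul_nonneg ((abs_nonneg _).trans (hW 0)) hρ
    rw [hq0]
    linarith

theorem exists_mvpLearner_eq {X Y : Type*} {s : ScoreFunctions X Y} {τmax r τ₁ α η ρ W : ℝ}
    {m : ℕ} {q : ℝ → ℝ} (hτ : 0 < τmax)
    (hr : 1 ≤ r) (hτ₁ : τ₁ ∈ Icc 0 τmax) (hm : 2 ≤ m) (hα : α ∈ Icc (0 : ℝ) 1) (hρ : 0 ≤ ρ)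
    (h : History X Y) (hW : ∀ i, |mvpWeight s α η τmax m h i| ≤ W) (hq0 : q 0 = 0)
    (hqm : 1 - q τmax ≤ ρ)
    (hq : ∀ a b, a ≤ b → b - a ≤ τmax / (r * m) → q a ≤ q b ∧ q b - q a ≤ ρ) :
    ∃ (a b c : ℝ) (i j : ℕ), c ∈ Icc (0 : ℝ) 1 ∧ i < m ∧ j < m ∧ a ∈ bin τmax m i ∧
      b ∈ bin τmax m j ∧
      mvpLearner s α η τmax r τ₁ m h =
        ENNReal.ofReal c • Measure.dirac a + ENNReal.ofReal (1 - c) • Measure.dirac b ∧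
      c * (mvpWeight s α η τmax m h i * (α - q a)) +
        (1 - c) * (mvpWeight s α η τmax m h j * (α - q b)) ≤ W * ρ := by
  cases h with
  | nil =>
    obtain ⟨i, hi, hb⟩ := exists_mem_bin hτ (zero_lt_two.trans_le hm) hτ₁
    refine ⟨τ₁, τ₁, 1, i, i, by simp, hi, hi, hb, hb, by simp [mvpLearner], ?_⟩
    -- In the first round all biases are zero, so the arbitrary `τ₁` causes no drift.
    have h0 : mvpWeight s α η τmax m [] i = 0 := by simp [mvpWeight, binBias]
    have h2 : 0 ≤ W * ρ := mul_nonneg ((abs_nonneg _).trans (hW 0)) hρ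
    rw [h0]
    linarith
  | cons z h => exact exists_mvpLaw_eq (q := q) hτ hr hm hα hρ hW hq0 hqm hq

theorem mem_bin_of_mvpLearner_ne_zero {X Y : Type*} {s : ScoreFunctions X Y}
    {τmax r τ₁ α η τ : ℝ} {m : ℕ} (hτ : 0 < τmax) (hr : 1 ≤ r) (hτ₁ : τ₁ ∈ Icc 0 τmax)
    (hm : 2 ≤ m) (hα : α ∈ Icc (0 : ℝ) 1) (hη : 0 < η) (hη1 : η ≤ 1) (h : History X Y)
    (hpos : mvpLearner s α η τmax r τ₁ m h {τ} ≠ 0) : ∃ i < m, τ ∈ bin τmax m i := by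
  -- Only the support of the law is wanted here, so a step function with `ρ = 1` serves as a dummy
  -- `q` and the drift bound is discarded.
  have hstep (a b : ℝ) (hab : a ≤ b) : (if 0 < a then (1 : ℝ) else 0) ≤ if 0 < b then 1 else 0 := by
    split_ifs <;> linarith
  obtain ⟨a, b, c, i, j, -, hi, hj, ha, hb, hL, -⟩ :=
    exists_mvpLearner_eq (s := s) (q := fun t => if 0 < t then (1 : ℝ) else 0) (ρ := 1) hτ hr hτ₁ hm
      hα zero_le_one h (abs_mvpWeight_le hα hη hη1 h) (by simp) (by simp [hτ])
      (fun a b hab _ => ⟨hstep a b hab, by split_ifs <;> norm_num⟩)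
  rw [hL] at hpos
  by_cases h1 : a = τ
  · exact ⟨i, hi, h1 ▸ ha⟩
  by_cases h2 : b = τ
  · exact ⟨j, hj, h2 ▸ hb⟩
  simp [h1, h2] at hpos

/-! ### One round of the game -/

theorem outerExpectation_prod_le {Ω : Type*} [MeasurableSpace Ω] (p : Measure Ω)
    [IsProbabilityMeasure p] (a b : ℝ) (c d : ℝ≥0∞) (F : Ω × ℝ → ℝ≥0∞)
    {Ga Gb : Ω → ℝ≥0∞} (hGa : Measurable Ga) (hGb : Measurable Gb)
    (ha : ∀ ω, F (ω, a) ≤ Ga ω) (hb : ∀ ω, F (ω, b) ≤ Gb ω) :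
    outerExpectation (p.prod (c • Measure.dirac a + d • Measure.dirac b)) F ≤
      c * ∫⁻ ω, Ga ω ∂p + d * ∫⁻ ω, Gb ω ∂p := by
  classical
  -- A measurable majorant of `F`: the value `⊤` off the two atoms costs nothing, and the minimum
  -- also handles `a = b`.
  set g : Ω × ℝ → ℝ≥0∞ := fun z =>
    min (if z.2 = a then Ga z.1 else ⊤) (if z.2 = b then Gb z.1 else ⊤) with hg
  have hmeas : Measurable g :=
    (Measurable.ite (measurable_snd (measurableSet_singleton a))
      (hGa.comp measurable_fst) measurable_const).min
    (Measurable.ite (measurable_snd (measurableSet_singleton b))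
      (hGb.comp measurable_fst) measurable_const)
  have hga : ∀ ω, g (ω, a) ≤ Ga ω := fun ω => (min_le_left _ _).trans (by simp)
  have hgb : ∀ ω, g (ω, b) ≤ Gb ω := fun ω => (min_le_right _ _).trans (by simp)
  have hle : ∀ z, F z ≤ g z := by
    rintro ⟨ω, τ⟩
    refine le_min ?_ ?_
    · by_cases h1 : τ = a
      · simpa [h1] using ha ω
      · simp [h1]
    · by_cases h1 : τ = b
      · simpa [h1] using hb ω
      · simp [h1]
  refine (iInf₂_le_of_le g hmeas (iInf_le _ hle)).trans ?_
  rw [lintegral_prod_symm' _ hmeas, lintegral_add_measure, lintegral_smul_measure,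
    lintegral_smul_measure, lintegral_dirac, lintegral_dirac]
  exact add_le_add (mul_le_mul_right (lintegral_mono hga) _)
    (mul_le_mul_right (lintegral_mono hgb) _)

theorem miscover_predictionSet {X Y : Type*} (f : X → Y → ℝ) (τ : ℝ) (ω : X × Y) :
    miscover (predictionSet f τ) ω.1 ω.2 = {ω : X × Y | f ω.1 ω.2 < τ}.indicator 1 ω := by
  simp [miscover, predictionSet, Set.indicator_apply]

section

variable {X Y : Type*} [MeasurableSpace X] [MeasurableSpace Y]

theorem measurableSet_score_lt {f : X → Y → ℝ} (hf : Measurable fun z : X × Y => f z.1 z.2)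
    (τ : ℝ) : MeasurableSet {ω : X × Y | f ω.1 ω.2 < τ} :=
  measurableSet_lt hf measurable_const

theorem integrable_miscover {f : X → Y → ℝ} (hf : Measurable fun z : X × Y => f z.1 z.2)
    (p : Measure (X × Y)) [IsProbabilityMeasure p] (τ : ℝ) :
    Integrable (fun ω : X × Y => miscover (predictionSet f τ) ω.1 ω.2) p := by
  simp only [miscover_predictionSet]
  exact (integrable_const (1 : ℝ)).indicator (measurableSet_score_lt hf τ)

theorem integral_affine_miscover {f : X → Y → ℝ} (hf : Measurable fun z : X × Y => f z.1 z.2)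
    (p : Measure (X × Y)) [IsProbabilityMeasure p] (τ x y : ℝ) :
    ∫ ω, (x + y * miscover (predictionSet f τ) ω.1 ω.2) ∂p =
      x + y * p.real {ω : X × Y | f ω.1 ω.2 < τ} := by
  rw [integral_add (integrable_const x) ((integrable_miscover hf p τ).const_mul y),
    integral_const_mul]
  simp only [miscover_predictionSet]
  rw [integral_indicator_one (measurableSet_score_lt hf τ)]
  simp

theorem lintegral_ofReal_miscover {f : X → Y → ℝ} (hf : Measurable fun z : X × Y => f z.1 z.2)
    (p : Measure (X × Y)) [IsProbabilityMeasure p] (τ x y : ℝ)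
    (h0 : ∀ ω : X × Y, 0 ≤ x + y * miscover (predictionSet f τ) ω.1 ω.2) :
    ∫⁻ ω, ENNReal.ofReal (x + y * miscover (predictionSet f τ) ω.1 ω.2) ∂p =
      ENNReal.ofReal (x + y * p.real {ω : X × Y | f ω.1 ω.2 < τ}) := by
  rw [← integral_affine_miscover hf]
  exact (ofReal_integral_eq_lintegral_ofReal ((integrable_const x).add
    ((integrable_miscover hf p τ).const_mul y)) (Filter.Eventually.of_forall h0)).symm

theorem measurable_ofReal_miscover {f : X → Y → ℝ}
    (hf : Measurable fun z : X × Y => f z.1 z.2) (τ x y : ℝ) :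
    Measurable fun ω : X × Y =>
      ENNReal.ofReal (x + y * miscover (predictionSet f τ) ω.1 ω.2) := by
  simp only [miscover_predictionSet]
  exact (((measurable_const.indicator (measurableSet_score_lt hf τ)).const_mul y).const_add
    x).ennreal_ofReal

theorem measureReal_score_lt_sub_le {f : X → Y → ℝ}
    (hf : Measurable fun z : X × Y => f z.1 z.2)
    {p : Measure (X × Y)} [IsProbabilityMeasure p] {w ρ : ℝ} (hρ : 0 ≤ ρ)
    (hp : IsSmooth (p.map fun z => f z.1 z.2) w ρ) {a b : ℝ} (hab : a ≤ b) (hw : b - a ≤ w) :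
    p.real {ω : X × Y | f ω.1 ω.2 < a} ≤ p.real {ω : X × Y | f ω.1 ω.2 < b} ∧
      p.real {ω : X × Y | f ω.1 ω.2 < b} - p.real {ω : X × Y | f ω.1 ω.2 < a} ≤ ρ := by
  refine ⟨measureReal_mono fun ω hω => lt_of_lt_of_le hω hab, ?_⟩
  have h1 := hp a b hw
  rw [Measure.map_apply hf measurableSet_Icc] at h1
  have h2 : p.real ((fun z : X × Y => f z.1 z.2) ⁻¹' Icc a b) ≤ ρ :=
    ENNReal.toReal_le_of_le_ofReal hρ h1
  have h3 : {ω : X × Y | f ω.1 ω.2 < b} ⊆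
      {ω : X × Y | f ω.1 ω.2 < a} ∪ (fun z : X × Y => f z.1 z.2) ⁻¹' Icc a b := by
    intro ω hω
    by_cases h : f ω.1 ω.2 < a
    · exact Or.inl h
    · exact Or.inr ⟨not_lt.mp h, le_of_lt hω⟩
  linarith [(measureReal_mono (μ := p) h3).trans (measureReal_union_le _ _)]

/-- The majorant is affine in the miscoverage indicator, so integrating it over the data just
replaces the indicator by its probability `q τ`; the drift bound then applies for every admissible
`p`. -/
theorem outerExpectation_mvpLearner_le {s : ScoreFunctions X Y} {τmax r τ₁ α η ρ W A B : ℝ}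
    {m : ℕ} (hτ : 0 < τmax) (hr : 1 ≤ r) (hτ₁ : τ₁ ∈ Icc 0 τmax) (hm : 2 ≤ m)
    (hα : α ∈ Icc (0 : ℝ) 1) (hρ : 0 ≤ ρ) {h : History X Y}
    (hs : Measurable fun z : X × Y => s h z.1 z.2) (hs0 : ∀ x y, s h x y ∈ Icc 0 τmax)
    (hW : ∀ i, |mvpWeight s α η τmax m h i| ≤ W) {p : Measure (X × Y)}
    (hp : p ∈ smoothDistributions s (τmax / (r * m)) ρ h) (hB : 0 ≤ B)
    {F : Round X Y → ℝ≥0∞}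
    (hF0 : ∀ (z : Round X Y) (j : ℕ), j < m → z.2 ∈ bin τmax m j →
      0 ≤ A + B * (mvpWeight s α η τmax m h j *
        (α - miscover (predictionSet (s h) z.2) z.1.1 z.1.2)))
    (hF : ∀ (z : Round X Y) (j : ℕ), j < m → z.2 ∈ bin τmax m j →
      F z ≤ ENNReal.ofReal (A + B * (mvpWeight s α η τmax m h j *
        (α - miscover (predictionSet (s h) z.2) z.1.1 z.1.2)))) :
    outerExpectation (p.prod (mvpLearner s α η τmax r τ₁ m h)) F ≤
      ENNReal.ofReal (A + B * (W * ρ)) := by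
  obtain ⟨hprob, hsm⟩ := hp
  have hm' : (0 : ℝ) < m := by exact_mod_cast (by omega : 0 < m)
  have hr0 : 0 < r := by linarith
  set q : ℝ → ℝ := fun τ => p.real {ω : X × Y | s h ω.1 ω.2 < τ} with hq
  have hq0 : q 0 = 0 := by
    have : {ω : X × Y | s h ω.1 ω.2 < 0} = ∅ := by
      ext ω; simpa using (hs0 ω.1 ω.2).1
    simp [hq, this]
  have hqm : 1 - q τmax ≤ ρ := by
    -- Scores do not exceed `τmax`, so `1 - q τmax` is the mass of the degenerate interval at
    -- `τmax`.
    have h1 := hsm τmax τmax (by rw [sub_self]; positivity)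
    rw [Measure.map_apply hs measurableSet_Icc] at h1
    have h2 : p.real ((fun z : X × Y => s h z.1 z.2) ⁻¹' Icc τmax τmax) ≤ ρ :=
      ENNReal.toReal_le_of_le_ofReal hρ h1
    have h3 : (fun z : X × Y => s h z.1 z.2) ⁻¹' Icc τmax τmax =
        {ω : X × Y | s h ω.1 ω.2 < τmax}ᶜ := by
      ext ω
      simp only [mem_preimage, mem_Icc, mem_compl_iff, mem_ofPred_eq, not_lt]
      exact ⟨fun h => h.1, fun h => ⟨h, (hs0 ω.1 ω.2).2⟩⟩
    rwa [h3, probReal_compl_eq_one_sub (measurableSet_score_lt hs τmax)] at h2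
  obtain ⟨a, b, c, i, j, hc, hi, hj, ha, hb, hL, hdrift⟩ :=
    exists_mvpLearner_eq (s := s) (q := q) hτ hr hτ₁ hm hα hρ h hW hq0 hqm
      (fun a b hab hw => measureReal_score_lt_sub_le hs hρ hsm hab hw)
  have hbound : ∀ τ k, k < m → τ ∈ bin τmax m k →
      ∃ G : X × Y → ℝ≥0∞, Measurable G ∧ (∀ ω, F (ω, τ) ≤ G ω) ∧
        0 ≤ A + B * (mvpWeight s α η τmax m h k * (α - q τ)) ∧
        ∫⁻ ω, G ω ∂p =
          ENNReal.ofReal (A + B * (mvpWeight s α η τmax m h k * (α - q τ))) := by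
    intro τ k hk hτk
    have e : ∀ t, A + B * (mvpWeight s α η τmax m h k * (α - t)) =
        (A + B * (mvpWeight s α η τmax m h k * α)) +
          (-(B * mvpWeight s α η τmax m h k)) * t := by
      intro t; ring
    have h0 : ∀ ω : X × Y, _ := fun ω => hF0 (ω, τ) k hk hτk
    have h1 : ∀ ω : X × Y, _ := fun ω => hF (ω, τ) k hk hτk
    simp only [e] at h0 h1 ⊢
    refine ⟨_, measurable_ofReal_miscover hs τ _ _, h1, ?_, lintegral_ofReal_miscover hs p τ _ _ h0⟩
    rw [hq, ← integral_affine_miscover hs]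
    exact integral_nonneg h0
  obtain ⟨Ga, hGa, hFa, ha0, hIa⟩ := hbound a i hi ha
  obtain ⟨Gb, hGb, hFb, hb0, hIb⟩ := hbound b j hj hb
  have hc1 : 0 ≤ 1 - c := sub_nonneg.mpr hc.2
  rw [hL]
  refine (outerExpectation_prod_le p a b _ _ F hGa hGb hFa hFb).trans ?_
  rw [hIa, hIb, ← ENNReal.ofReal_mul hc.1, ← ENNReal.ofReal_mul hc1,
    ← ENNReal.ofReal_add (mul_nonneg hc.1 ha0) (mul_nonneg hc1 hb0)]
  refine ENNReal.ofReal_le_ofReal ?_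
  linarith [mul_le_mul_of_nonneg_left hdrift hB]

end

/-! ### The value of the game -/

/-- Backward induction: the compensated potential is a supermartingale up to a drift of `exp T * ρ /
(4 η)` per remaining round. -/
theorem gameValue_mvpLearner_le {X Y : Type*} [MeasurableSpace X] [MeasurableSpace Y]
    {s : ScoreFunctions X Y} {τmax r τ₁ α η ρ : ℝ} {m T : ℕ} (hτ : 0 < τmax) (hr : 1 ≤ r)
    (hτ₁ : τ₁ ∈ Icc 0 τmax) (hm : 2 ≤ m) (hT : 0 < T) (hα : α ∈ Icc (0 : ℝ) 1) (hρ : 0 ≤ ρ)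
    (hη : 0 < η) (hη4 : η ≤ 1 / 4) (hs : ∀ h, Measurable fun z : X × Y => s h z.1 z.2)
    (hs0 : ∀ h x y, s h x y ∈ Icc 0 τmax) (k : ℕ) (h : History X Y) (hh : InBins τmax m h)
    (hl : h.length + k = T) :
    gameValue (smoothDistributions s (τmax / (r * m)) ρ) (mvpLearner s α η τmax r τ₁ m)
        (fun h => ENNReal.ofReal |1 / (T : ℝ) * totalMiscover s h - α|) k h ≤
      ENNReal.ofReal ((mvpPotential s α η τmax m T h +
        Real.sqrt (m * (T + m)) * Real.logb 2 ((T : ℝ) + 2) +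
          k * (Real.exp T * ρ / (4 * η))) / T) := by
  have hT0 : (0 : ℝ) < T := by exact_mod_cast hT
  set C := Real.sqrt (m * (T + m)) * Real.logb 2 ((T : ℝ) + 2) with hC
  have hC0 : 0 ≤ C :=
    mul_nonneg (Real.sqrt_nonneg _) (zero_le_one.trans (one_le_logb_two_add T))
  set N := Real.exp T * ρ / (4 * η) with hN
  have hN0 : 0 ≤ N := by positivity
  induction k generalizing h with
  | zero =>
    rw [gameValue]
    refine ENNReal.ofReal_le_ofReal ?_
    rw [Nat.cast_zero, zero_mul, add_zero]
    exact abs_totalMiscover_sub_le hτ hη hT hh hl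
  | succ k ih =>
    rw [gameValue]
    refine iSup₂_le fun p hp => ?_
    have hU := mvpPotential_nonneg (s := s) (α := α) (η := η) hτ hh (by omega : h.length ≤ T)
    have hstep : ∀ (z : Round X Y) (j : ℕ), j < m → z.2 ∈ bin τmax m j →
        InBins τmax m (z :: h) ∧ (mvpPotential s α η τmax m T (z :: h) + C + k * N) / T ≤
          (mvpPotential s α η τmax m T h + C + k * N) / T + 1 / (4 * η * T) *
            (mvpWeight s α η τmax m h j *
              (α - miscover (predictionSet (s h) z.2) z.1.1 z.1.2)) := by
      intro z j hj hz
      refine ⟨List.forall_mem_cons.mpr ⟨⟨j, hj, hz⟩, hh⟩, ?_⟩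
      have h1 := mvpPotential_cons_le (s := s) (T := T) (h := h) hτ hα hη hη4 hj hz
      have h2 : (mvpPotential s α η τmax m T h + C + k * N) / T + 1 / (4 * η * T) *
            (mvpWeight s α η τmax m h j *
              (α - miscover (predictionSet (s h) z.2) z.1.1 z.1.2)) =
          (mvpPotential s α η τmax m T h + mvpWeight s α η τmax m h j *
            (α - miscover (predictionSet (s h) z.2) z.1.1 z.1.2) / (4 * η) + C + k * N) / T := by
        field_simp
        ring
      rw [h2]
      gcongr
    have hW : ∀ i, |mvpWeight s α η τmax m h i| ≤ Real.exp T := fun i =>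
      (abs_mvpWeight_le hα hη (by linarith) h i).trans
        (Real.exp_le_exp.mpr (by exact_mod_cast (by omega : h.length ≤ T)))
    refine (outerExpectation_mvpLearner_le hτ hr hτ₁ hm hα hρ (hs h) (hs0 h) hW hp
      (A := (mvpPotential s α η τmax m T h + C + k * N) / T) (B := 1 / (4 * η * T))
      (by positivity) (fun z j hj hz => ?_) (fun z j hj hz => ?_)).trans
      (ENNReal.ofReal_le_ofReal (le_of_eq ?_))
    · obtain ⟨h1, h2⟩ := hstep z j hj hz
      refine le_trans ?_ h2
      have := mvpPotential_nonneg (s := s) (α := α) (η := η) hτ h1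
        (by rw [List.length_cons]; omega : (z :: h).length ≤ T)
      positivity
    · obtain ⟨h1, h2⟩ := hstep z j hj hz
      exact (ih (z :: h) h1 (by rw [List.length_cons]; omega)).trans
        (ENNReal.ofReal_le_ofReal h2)
    · rw [hN]
      push_cast
      field_simp
      ring

theorem gameValue_le_one {X Y : Type*} [MeasurableSpace X] [MeasurableSpace Y]
    (P : History X Y → Set (Measure (X × Y))) (hP : ∀ h, ∀ p ∈ P h, IsProbabilityMeasure p)
    (L : Learner X Y) (hL : ∀ h, IsProbabilityMeasure (L h)) (payoff : History X Y → ℝ≥0∞)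
    {T : ℕ} (hpay : ∀ h, h.length = T → payoff h ≤ 1) (k : ℕ) (h : History X Y)
    (hl : h.length + k = T) : gameValue P L payoff k h ≤ 1 := by
  induction k generalizing h with
  | zero => exact hpay h hl
  | succ k ih =>
    rw [gameValue]
    refine iSup₂_le fun p hp => ?_
    have := hP h p hp
    have := hL h
    refine (iInf₂_le_of_le (fun _ => 1) measurable_const (iInf_le _ fun z =>
      ih (z :: h) (by rw [List.length_cons]; omega))).trans ?_
    simp

theorem isProbabilityMeasure_mvpLearner {X Y : Type*} (s : ScoreFunctions X Y)
    (α η τmax r τ₁ : ℝ) (m : ℕ) (h : History X Y) :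
    IsProbabilityMeasure (mvpLearner s α η τmax r τ₁ m h) := by
  classical
  cases h with
  | nil => exact Measure.dirac.isProbabilityMeasure
  | cons z h =>
    rw [mvpLearner, mvpLaw]
    split_ifs with hex
    · have hc := mvpProb_mem (mvpWeight s α η τmax m (z :: h)) (Nat.find hex)
      constructor
      simp only [Measure.add_apply, Measure.smul_apply, measure_univ, smul_eq_mul, mul_one]
      rw [← ENNReal.ofReal_add hc.1 (sub_nonneg.mpr hc.2)]
      simp
    · exact Measure.dirac.isProbabilityMeasure
    · exact Measure.dirac.isProbabilityMeasure

theorem totalMiscover_mem {X Y : Type*} (s : ScoreFunctions X Y) (h : History X Y) :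
    totalMiscover s h ∈ Icc (0 : ℝ) h.length := by
  induction h with
  | nil => simp [totalMiscover]
  | cons z h ih =>
    rw [totalMiscover, List.length_cons, Nat.cast_add, Nat.cast_one]
    have h1 := miscover_nonneg (predictionSet (s h) z.2) z.1.1 z.1.2
    have h2 := miscover_le_one (predictionSet (s h) z.2) z.1.1 z.1.2
    exact ⟨by linarith [ih.1], by linarith [ih.2]⟩

theorem miscoverageValue_mvpLearner_le_one {X Y : Type*} [MeasurableSpace X] [MeasurableSpace Y]
    (s : ScoreFunctions X Y) (w ρ α η τmax r τ₁ : ℝ) (m : ℕ) {T : ℕ} (hT : 0 < T)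
    (hα : α ∈ Icc (0 : ℝ) 1) :
    miscoverageValue (smoothDistributions s w ρ) s T α (mvpLearner s α η τmax r τ₁ m) ≤ 1 := by
  refine gameValue_le_one _ (fun h p hp => hp.1) _
    (isProbabilityMeasure_mvpLearner s α η τmax r τ₁ m) _ (T := T) (fun h hl => ?_) T []
    (by simp)
  rw [ENNReal.ofReal_le_one, abs_le]
  have hT0 : (0 : ℝ) < T := by exact_mod_cast hT
  have h1 := totalMiscover_mem s h
  rw [hl] at h1
  have h2 : 0 ≤ 1 / (T : ℝ) * totalMiscover s h := mul_nonneg (by positivity) h1.1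
  have h3 : 1 / (T : ℝ) * totalMiscover s h ≤ 1 := by
    rw [one_div_mul_eq_div]; exact (div_le_one hT0).mpr h1.2
  exact ⟨by linarith [hα.2], by linarith [hα.1]⟩

/-! ### The bound -/

/-- The worst case is `m = 2`, where `13.6 log 2 ≈ 9.43`. -/
theorem three_mul_sqrt_le {m : ℕ} (hm : 2 ≤ m) :
    3 * Real.sqrt m ≤ Real.sqrt (13.6 * m * Real.log m) := by
  have hm' : (2 : ℝ) ≤ m := by exact_mod_cast hm
  have h1 : Real.log 2 ≤ Real.log m := Real.log_le_log (by norm_num) hm'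
  have h2 := Real.log_two_gt_d9
  apply Real.le_sqrt_of_sq_le
  rw [mul_pow, Real.sq_sqrt (by positivity)]
  nlinarith

theorem fMVP_div_le_sum_roundsInBin {X Y : Type*} {τmax : ℝ} {m : ℕ} {z : History X Y} {i T : ℕ}
    (hz : z.length = T) (hi : i < m) (t : Fin z.length) (ht : (z.get t).2 ∈ bin τmax m i) {c : ℝ} (hc : 0 ≤ c) :
    fMVP T / (T : ℝ) * c ≤ ∑ i ∈ Finset.range m,
      fMVP (roundsInBin τmax m z i).card / ((roundsInBin τmax m z i).card : ℝ) * c := by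
  have hpos : 1 ≤ (roundsInBin τmax m z i).card :=
    Finset.card_pos.mpr ⟨t, by simpa [roundsInBin] using ht⟩
  have hle : (roundsInBin τmax m z i).card ≤ T := by
    simpa [hz] using Finset.card_le_univ (roundsInBin τmax m z i)
  refine (mul_le_mul_of_nonneg_right (fMVP_div_antitone hpos hle) hc).trans ?_
  exact Finset.single_le_sum (f := fun i => fMVP (roundsInBin τmax m z i).card /
    ((roundsInBin τmax m z i).card : ℝ) * c) (fun i _ => mul_nonneg
      (div_nonneg (fMVP_pos _).le (Nat.cast_nonneg _)) hc) (Finset.mem_range.mpr hi)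

theorem one_le_fMVP_div_mul_sqrt {m T : ℕ} (hm : 2 ≤ m) (hT : 1 ≤ T) (hTm : T < m) :
    1 ≤ fMVP T / (T : ℝ) * Real.sqrt (13.6 * m * Real.log m) := by
  have hT0 : (0 : ℝ) < T := by exact_mod_cast hT
  have h1 : Real.sqrt T ≤ fMVP T :=
    (Real.sqrt_le_sqrt (by linarith)).trans (sqrt_le_fMVP T)
  have h2 : Real.sqrt T ≤ Real.sqrt (13.6 * m * Real.log m) := by
    have : Real.sqrt T ≤ Real.sqrt m := Real.sqrt_le_sqrt (by exact_mod_cast hTm.le)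
    linarith [three_mul_sqrt_le hm, Real.sqrt_nonneg (m : ℝ)]
  rw [div_mul_eq_mul_div, le_div_iff₀ hT0, one_mul]
  calc (T : ℝ) = Real.sqrt T * Real.sqrt T := (Real.mul_self_sqrt hT0.le).symm
    _ ≤ _ := mul_le_mul h1 h2 (Real.sqrt_nonneg _) (fMVP_pos _).le

/-- With `m ≤ T`, `√(m (T + m)) ≤ 1.5 √(m T)`; the logarithm `l` is at least 2 since `T ≥ 2`, so `2
+ 1.5 l + 0.1 ≤ 3 l`. -/
theorem potential_bound_le {m T : ℕ} (hm : 2 ≤ m) (hmT : m ≤ T) {N : ℝ} (hN : N ≤ 1 / 10) :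
    (2 * Real.sqrt (m * T) + Real.sqrt (m * (T + m)) * Real.logb 2 ((T : ℝ) + 2) + N) / T ≤
      fMVP T / (T : ℝ) * Real.sqrt (13.6 * m * Real.log m) := by
  have hm' : (2 : ℝ) ≤ m := by exact_mod_cast hm
  have hmT' : (m : ℝ) ≤ T := by exact_mod_cast hmT
  have hT0 : (0 : ℝ) < T := by linarith
  set l := Real.logb 2 ((T : ℝ) + 2) with hl
  have hl2 : 2 ≤ l := by
    rw [hl, Real.le_logb_iff_rpow_le (by norm_num) (by positivity)]
    norm_num
    linarith
  have h1 : Real.sqrt (m * (T + m)) ≤ 1.5 * Real.sqrt (m * T) := by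
    apply Real.sqrt_le_iff.mpr
    refine ⟨by positivity, ?_⟩
    rw [mul_pow, Real.sq_sqrt (by positivity)]
    nlinarith
  have h2 : 1 ≤ Real.sqrt (m * T) := Real.one_le_sqrt.mpr (by nlinarith)
  rw [div_mul_eq_mul_div]
  refine div_le_div_of_nonneg_right ?_ hT0.le
  have h3 : Real.sqrt T ≤ Real.sqrt ((T : ℝ) + 1) := Real.sqrt_le_sqrt (by linarith)
  calc 2 * Real.sqrt (m * T) + Real.sqrt (m * (T + m)) * l + N
      ≤ 2 * Real.sqrt (m * T) + 1.5 * Real.sqrt (m * T) * l + 1 / 10 * Real.sqrt (m * T) := by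
        gcongr; linarith
    _ ≤ Real.sqrt (m * T) * (3 * l) := by nlinarith
    _ = Real.sqrt T * l * (3 * Real.sqrt m) := by
        rw [Real.sqrt_mul (by positivity)]; ring
    _ ≤ fMVP T * Real.sqrt (13.6 * m * Real.log m) := by
        rw [fMVP_eq]
        have := three_mul_sqrt_le hm
        gcongr

theorem learningRate_le {m : ℕ} (hm : 2 ≤ m) : Real.sqrt (Real.log m / (6.6 * m)) ≤ 1 / 4 := by
  have hm' : (2 : ℝ) ≤ m := by exact_mod_cast hm
  apply Real.sqrt_le_iff.mpr
  refine ⟨by norm_num, ?_⟩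
  have he := Real.exp_one_gt_d9
  -- The tangent at `e` gives `log m ≤ m / e`, and `1 / e < 6.6 / 16`.
  have h1 := Real.log_le_sub_one_of_pos (show 0 < (m : ℝ) / Real.exp 1 by positivity)
  rw [Real.log_div (by positivity) (by positivity), Real.log_exp] at h1
  have h2 : (m : ℝ) / Real.exp 1 ≤ m / 2.7 := by gcongr; linarith
  rw [div_le_iff₀ (by positivity)]
  norm_num at h2 ⊢
  linarith

theorem lemma2 (m T : ℕ) (hm : 2 ≤ m) (hT : 1 ≤ T) :
    ∃ ρ₀ : ℝ, 0 < ρ₀ ∧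
      ∀ (X : Type*) (Y : Type*) [MeasurableSpace X] [MeasurableSpace Y]
        (τmax r τ₁ α η ρ : ℝ) (s : ScoreFunctions X Y),
        0 < τmax → 1 ≤ r → τ₁ ∈ Icc 0 τmax → α ∈ Icc (0 : ℝ) 1 →
        Real.sqrt (Real.log m / (6.8 * m)) ≤ η →
        η ≤ Real.sqrt (Real.log m / (6.6 * m)) →
        0 < ρ → ρ ≤ ρ₀ →
        (∀ h, Measurable fun z : X × Y => s h z.1 z.2) →
        (∀ h x y, s h x y ∈ Icc 0 τmax) →
        ∀ z : History X Y, z.length = T → IsRun (mvpLearner s α η τmax r τ₁ m) z →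
          miscoverageValue (smoothDistributions s (τmax / (r * m)) ρ) s T α
              (mvpLearner s α η τmax r τ₁ m) ≤
            ENNReal.ofReal (∑ i ∈ Finset.range m,
              fMVP (roundsInBin τmax m z i).card / ((roundsInBin τmax m z i).card : ℝ) *
                Real.sqrt (13.6 * m * Real.log m)) := by
  have hm' : (2 : ℝ) ≤ m := by exact_mod_cast hm
  have hT0 : (0 : ℝ) < T := by exact_mod_cast hT
  have hlog : 0 < Real.log m := Real.log_pos (by linarith)
  set η₀ := Real.sqrt (Real.log m / (6.8 * m)) with hη₀
  have hη₀0 : 0 < η₀ := Real.sqrt_pos.mpr (by positivity)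
  -- Chosen so that the total drift `T * (exp T * ρ / (4 η))` is at most `1 / 10`. The lower bound
  -- `η₀` on `η` makes this depend on `m` and `T` only.
  refine ⟨2 / 5 * η₀ / (T * Real.exp T), by positivity, ?_⟩
  intro X Y _ _ τmax r τ₁ α η ρ s hτ hr hτ₁ hα hη1 hη2 hρ hρ₀ hs hs0 z hz hrun
  have hη : 0 < η := hη₀0.trans_le hη1
  have hη4 : η ≤ 1 / 4 := hη2.trans (learningRate_le hm)
  have hsum : fMVP T / (T : ℝ) * Real.sqrt (13.6 * m * Real.log m) ≤ ∑ i ∈ Finset.range m,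
      fMVP (roundsInBin τmax m z i).card / ((roundsInBin τmax m z i).card : ℝ) *
        Real.sqrt (13.6 * m * Real.log m) := by
    cases z with
    | nil => simp at hz; omega
    -- The most recent round alone already provides an occupied bin.
    | cons z h =>
      obtain ⟨i, hi, hzi⟩ :=
        mem_bin_of_mvpLearner_ne_zero hτ hr hτ₁ hm hα hη (by linarith) h hrun.1
      exact fMVP_div_le_sum_roundsInBin hz hi ⟨0, by simp⟩ hzi (Real.sqrt_nonneg _)
  rcases lt_or_ge T m with hTm | hmT
  · refine (miscoverageValue_mvpLearner_le_one s _ ρ α η τmax r τ₁ m hT hα).trans ?_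
    rw [ENNReal.one_le_ofReal]
    exact (one_le_fMVP_div_mul_sqrt hm hT hTm).trans hsum
  · refine (gameValue_mvpLearner_le hτ hr hτ₁ hm hT hα hρ.le hη hη4 hs hs0 T []
      (fun z hz => by simp at hz) (by simp)).trans (ENNReal.ofReal_le_ofReal ?_)
    rw [mvpPotential_nil]
    refine (potential_bound_le hm hmT ?_).trans hsum
    rw [le_div_iff₀ (by positivity)] at hρ₀
    rw [← mul_div_assoc, div_le_iff₀ (by positivity)]
    linarith
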